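/- A two-qubit state is a positive semidefinite operator of trace one on $\mathbb{C}^2\otimes\mathbb{C}^2$; it is separable if it is a convex combination of product states, and absolutely separable if $U\rho U^\dagger$ is separable for every unitary $U$ on $\mathbb{C}^2\otimes\mathbb{C}^2$. Let $\mathbf{AS}$ be the set of absolutely separable two-qubit states; its boundary is taken inside the set of all two-qubit states. For an orthonormal basis $\psi=(\psi_1,\dots,\psi_4)$ of $\mathbb{C}^2\otimes\mathbb{C}^2$ and $\kappa\in\mathbb{R}$, let $F_{\psi,\kappa}$ be the set of states $\sum_{i=1}^4\lambda_i|\psi_i\rangle\langle\psi_i|$ with $\lambda_1\ge\lambda_2\ge\lambda_3\ge\lambda_4>0$, $\sum_i\lambda_i=1$, $\lambda_1-\lambda_3=2\sqrt{\lambda_2\lambda_4}$ and $\lambda_2/\lambda_4=\kappa$. (a) There is a state $\rho\in\mathbf{AS}$ of rank $4$ which is a boundary point of $\mathbf{AS}$, whose eigenvalues $\lambda_1\ge\lambda_2\ge\lambda_3\ge\lambda_4$ satisfy $\lambda_1-\lambda_3=2\sqrt{\lambda_2\lambda_4}$, and which is not an extreme point of $\mathbf{AS}$. (b) For every $\psi$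 and $\kappa$, the set $F_{\psi,\kappa}$ is convex, each of its members is a rank-$4$ element of $\mathbf{AS}$ and a boundary point of $\mathbf{AS}$, and for all distinct $\sigma_1,\sigma_2\in F_{\psi,\kappa}$ and $0<x<1$ the state $x\sigma_1+(1-x)\sigma_2$ is not an extreme point of $\mathbf{AS}$. (c) For every $\psi$, the set $F_{\psi,5/2}$ contains two distinct states, one with $\lambda_4=0.1$ and one with $\lambda_4=0.11$. -/

import Mathlib

open scoped Kronecker ComplexOrder

/-- Density matrices (states) on the Hilbert space with orthonormal basis indexed by `n`:
positive semidefinite complex matrices of trace one. -/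
def densityMatrices (n : Type*) [Fintype n] : Set (Matrix n n ℂ) :=
  {ρ | ρ.PosSemidef ∧ ρ.trace = 1}

/-- Separable states of a bipartite system: finite convex combinations of product states. -/
def separableStates (m n : Type*) [Fintype m] [Fintype n] :
    Set (Matrix (m × n) (m × n) ℂ) :=
  convexHull ℝ {ρ | ∃ A ∈ densityMatrices m, ∃ B ∈ densityMatrices n, ρ = A ⊗ₖ B}

/-- Absolutely separable states: states that no global unitary makes entangled,
i.e. `U ρ U†` is separable for every unitary `U` on the whole space. -/
def absolutelySeparable (m n : Type*) [Fintype m] [Fintype n] [DecidableEq m] [DecidableEq n] :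
    Set (Matrix (m × n) (m × n) ℂ) :=
  {ρ | ρ ∈ densityMatrices (m × n) ∧
    ∀ U ∈ Matrix.unitaryGroup (m × n) ℂ, U * ρ * star U ∈ separableStates m n}

/-- The set **AS** of absolutely separable states of two qubits. -/
def AS : Set (Matrix (Fin 2 × Fin 2) (Fin 2 × Fin 2) ℂ) :=
  absolutelySeparable (Fin 2) (Fin 2)

/-- The boundary of **AS**: its topological frontier inside the space of two-qubit states. -/
def boundaryAS : Set (Matrix (Fin 2 × Fin 2) (Fin 2 × Fin 2) ℂ) :=
  Subtype.val '' frontier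
    (Subtype.val ⁻¹' AS : Set (densityMatrices (Fin 2 × Fin 2)))

/-- Orthonormal bases of the two-qubit Hilbert space. -/
abbrev TwoQubitBasis : Type :=
  OrthonormalBasis (Fin 4) ℂ (EuclideanSpace ℂ (Fin 2 × Fin 2))

/-- The operator `∑ i, l i |ψ i⟩⟨ψ i|`, for an orthonormal basis `ψ` and real numbers `l i`. -/
noncomputable def spectralState (ψ : TwoQubitBasis) (l : Fin 4 → ℝ) :
    Matrix (Fin 2 × Fin 2) (Fin 2 × Fin 2) ℂ :=
  ∑ i, (l i : ℂ) • Matrix.vecMulVec (ψ i).ofLp (star (ψ i).ofLp)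

/-- `l` is the spectrum, in decreasing order, of a full-rank two-qubit state, and it satisfies
`λ₁ - λ₃ = 2 √(λ₂ λ₄)` (with `l 0, l 1, l 2, l 3` for `λ₁, λ₂, λ₃, λ₄`). -/
structure IsCriticalSpectrum (l : Fin 4 → ℝ) : Prop where
  antitone : Antitone l
  pos : ∀ i, 0 < l i
  sum_eq_one : ∑ i, l i = 1
  critical : l 0 - l 2 = 2 * Real.sqrt (l 1 * l 3)

/-- The states with eigenbasis `ψ` (with eigenvalues decreasing along `ψ`) whose spectrum is
critical and has the ratio `λ₂ / λ₄ = κ`. -/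
def criticalFamily (ψ : TwoQubitBasis) (κ : ℝ) :
    Set (Matrix (Fin 2 × Fin 2) (Fin 2 × Fin 2) ℂ) :=
  {ρ | ∃ l : Fin 4 → ℝ, IsCriticalSpectrum l ∧ l 1 / l 3 = κ ∧ ρ = spectralState ψ l}

/-! The engine is the spectral criterion for a positive spectrum: absolute separability is
equivalent to `λ₁ - λ₃ ≤ 2√(λ₂λ₄)`.

Sufficiency. The spin-flip form on `ℂ² ⊗ ℂ²` is the polarization of `2 det`, so its isotropic
vectors are the product vectors. Takagi factorization writes `ρ = ∑ sᵢ |vᵢ⟩⟨vᵢ|` with `vᵢ`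
orthonormal for this form, and `ρ` is separable once `s₁ ≤ s₂ + s₃ + s₄`. The difference of the two
sides is a trace `tr(WΛ)`, where `Λ = diag(λ)` and `W` is Hermitian of signature `(3,1)` and
isospectral with `W⁻¹`. Hence `W` has spectrum `a, 1, a⁻¹, -1`, and von Neumann's trace inequality
gives `tr(WΛ) ≥ -λ₁ + λ₂/a + λ₃ + aλ₄ ≥ -λ₁ + λ₃ + 2√(λ₂λ₄)`
(`Matrix.orthogonal_congruence_value_le`).

Necessity. A unitary moves `λ₁` onto the singlet, `λ₃` onto the triplet `|01⟩ + |10⟩` and `λ₂, λ₄`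
onto `|00⟩, |11⟩`; a partial-transpose witness then yields the inequality (`le_of_mem_AS`).

So equality forces a boundary point. If moreover `λ₂ = κλ₄`, the equality reads `λ₁ - λ₃ = 2√κ λ₄`,
which is linear in the spectrum. The family is therefore convex, and proper mixtures of distinct
members are not extreme. -/

section

open Matrix

/-! ### Takagi factorization -/

/-- A symmetric complex bilinear form on a finite-dimensional inner product space has an
orthonormal family of full size on which it is diagonal with nonnegative entries. -/
theorem exists_orthonormal_diagonalizing_symm_bilin (n : ℕ) :
    ∀ {E : Type} [NormedAddCommGroup E] [InnerProductSpace ℂ E] [FiniteDimensional ℂ E]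
      (_ : Module.finrank ℂ E = n) (B : E →ₗ[ℂ] E →ₗ[ℂ] ℂ) (_ : ∀ x y, B x y = B y x),
      ∃ (v : Fin n → E) (s : Fin n → ℝ), Orthonormal ℂ v ∧ (∀ i, 0 ≤ s i) ∧
        ∀ i j, B (v i) (v j) = if i = j then (s i : ℂ) else 0 := by
  induction n with
  | zero =>
    intro E _ _ _ _ B _
    exact ⟨Fin.elim0, Fin.elim0, ⟨fun i => i.elim0, fun i => i.elim0⟩, fun i => i.elim0,
      fun i => i.elim0⟩
  | succ n ih =>
    intro E _ _ _ hE B hB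
    have hnt : Nontrivial E := Module.nontrivial_of_finrank_pos (R := ℂ) (by omega)
    have : FiniteDimensional ℝ E := FiniteDimensional.complexToReal E
    have : ProperSpace E := FiniteDimensional.proper ℂ E
    have hcont : Continuous fun x : E => (B x x).re := by
      have h1 : Continuous fun x : E => LinearMap.toContinuousLinearMap (B x) :=
        ((LinearMap.toContinuousLinearMap (𝕜 := ℂ) (E := E) (F' := ℂ)).toLinearMap ∘ₗ B
          ).continuous_of_finiteDimensional
      exact Complex.continuous_re.comp (h1.clm_apply continuous_id)
    -- A maximizer of `Re B(x, x)` on the unit sphere is the first vector; the induction continues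
    -- on its orthogonal complement.
    obtain ⟨x, hx, hmax⟩ := (isCompact_sphere (0 : E) 1).exists_isMaxOn
      (by
        obtain ⟨u, hu⟩ := exists_ne (0 : E)
        refine ⟨((‖u‖ : ℂ)⁻¹) • u, ?_⟩
        simp [norm_smul, hu]) hcont.continuousOn
    have hx1 : ‖x‖ = 1 := by simpa using hx
    have hle : ∀ y : E, (B y y).re ≤ (B x x).re * ‖y‖ ^ 2 := by
      intro y
      rcases eq_or_ne y 0 with rfl | hy
      · simp
      have hn : ‖y‖ ≠ 0 := norm_ne_zero_iff.mpr hy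
      have := hmax (show ((‖y‖ : ℂ)⁻¹) • y ∈ Metric.sphere (0 : E) 1 by simp [norm_smul, hy])
      simp only [Set.mem_ofPred_eq, map_smul, LinearMap.smul_apply, smul_eq_mul] at this
      rw [← mul_assoc, ← Complex.ofReal_inv, ← Complex.ofReal_mul, Complex.re_ofReal_mul] at this
      have h2 : (B y y).re = (‖y‖⁻¹ * ‖y‖⁻¹ * (B y y).re) * ‖y‖ ^ 2 := by
        field_simp
      rw [h2]
      exact mul_le_mul_of_nonneg_right this (by positivity)
    have habs : ∀ y : E, ‖B y y‖ ≤ (B x x).re * ‖y‖ ^ 2 := by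
      intro y
      obtain ⟨c, hc1, hc2⟩ : ∃ c : ℂ, ‖c‖ = 1 ∧ c * (B y y) = ‖B y y‖ := by
        rcases eq_or_ne (B y y) 0 with h | h
        · exact ⟨1, by simp [h]⟩
        · have hn : ‖B y y‖ ≠ 0 := norm_ne_zero_iff.mpr h
          refine ⟨‖B y y‖ / B y y, by simp [hn], by field_simp⟩
      -- Scaling `y` by `d` multiplies `B y y` by `d² = c`, so the bound on real parts also bounds
      -- the modulus.
      obtain ⟨d, hd⟩ := IsAlgClosed.exists_pow_nat_eq c (n := 2) (by norm_num)
      have hd1 : ‖d‖ = 1 := by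
        have : ‖d‖ ^ 2 = 1 := by rw [← norm_pow, hd, hc1]
        exact (pow_eq_one_iff_of_nonneg (norm_nonneg d) two_ne_zero).mp this
      have := hle (d • y)
      simp only [map_smul, LinearMap.smul_apply, smul_eq_mul, norm_smul, hd1, one_mul] at this
      rwa [← mul_assoc, ← sq, hd, hc2, Complex.ofReal_re] at this
    have hm : B x x = ((B x x).re : ℂ) := by
      have h1 := habs x
      rw [hx1, one_pow, mul_one] at h1
      have h2 : 0 ≤ B x x := Complex.re_eq_norm.mp (le_antisymm (Complex.re_le_norm _) h1)
      exact Complex.ext rfl (by simpa using (Complex.nonneg_iff.mp h2).2.symm)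
    have hm0 : 0 ≤ (B x x).re := by
      have h1 := habs x
      rw [hx1, one_pow, mul_one] at h1
      exact (norm_nonneg _).trans h1
    have hre : ∀ y : E, inner ℂ x y = 0 → (B x y).re = 0 := by
      intro y hy
      -- First variation of the maximum along `x + t y`: a term linear in `t` is dominated by a
      -- quadratic one, so it vanishes.
      have key : ∀ t : ℝ, 2 * t * (B x y).re ≤ t ^ 2 * ((B x x).re * ‖y‖ ^ 2 - (B y y).re) := by
        intro t
        have h1 := hle (x + (t : ℂ) • y)
        have h2 : ‖x + (t : ℂ) • y‖ ^ 2 = 1 + t ^ 2 * ‖y‖ ^ 2 := by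
          have := norm_add_sq_eq_norm_sq_add_norm_sq_of_inner_eq_zero (𝕜 := ℂ) x ((t : ℂ) • y)
            (by rw [inner_smul_right, hy, mul_zero])
          rw [sq, this, hx1, norm_smul, Complex.norm_real, Real.norm_eq_abs]
          nlinarith [sq_abs t]
        rw [h2] at h1
        simp only [map_add, map_smul, LinearMap.add_apply, LinearMap.smul_apply, smul_eq_mul,
          hB y x, Complex.add_re, Complex.re_ofReal_mul] at h1
        nlinarith
      set R := (B x y).re
      set C := (B x x).re * ‖y‖ ^ 2 - (B y y).re with hC
      have hC0 : 0 ≤ C := by rw [hC]; linarith [hle y]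
      -- The `+ 1` keeps the denominator positive when `C = 0`.
      have h := key (R / (C + 1))
      have h3 : (R / (C + 1)) * (C + 1) = R := by field_simp
      have h4 : 2 * R ^ 2 * (C + 1) ≤ R ^ 2 * C := by
        have := mul_le_mul_of_nonneg_right h (by positivity : 0 ≤ (C + 1) ^ 2)
        calc 2 * R ^ 2 * (C + 1) = 2 * (R / (C + 1)) * R * (C + 1) ^ 2 := by field_simp
          _ ≤ _ := this
          _ = R ^ 2 * C := by field_simp
      have : R ^ 2 = 0 := by nlinarith [sq_nonneg R, mul_nonneg (sq_nonneg R) hC0]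
      exact pow_eq_zero_iff (two_ne_zero) |>.mp this
    have horth : ∀ y : E, inner ℂ x y = 0 → B x y = 0 := by
      intro y hy
      apply Complex.ext (hre y hy)
      -- The real part of `B x (I • y)` is minus the imaginary part of `B x y`.
      have := hre (Complex.I • y) (by rw [inner_smul_right, hy, mul_zero])
      simpa using this
    have hx0 : x ≠ 0 := by
      rintro rfl
      simp at hx1
    have : Fact (Module.finrank ℂ E = n + 1) := ⟨hE⟩
    obtain ⟨v, s, hv, hs, hd⟩ := ih (E := (Submodule.span ℂ {x})ᗮ)
      (Submodule.finrank_orthogonal_span_singleton hx0)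
      (B.domRestrict₁₂ _ _) (fun a b => hB (a : E) b)
    have hvx : ∀ i, inner ℂ x (v i : E) = 0 := fun i =>
      Submodule.mem_orthogonal_singleton_iff_inner_right.mp (v i).2
    refine ⟨Fin.cons x fun i => (v i : E), Fin.cons (B x x).re s, ⟨?_, ?_⟩, ?_, ?_⟩
    · refine Fin.cases (by simpa using hx1) fun i => ?_
      simpa using hv.1 i
    · intro i j
      refine Fin.cases ?_ (fun i => ?_) i <;> refine Fin.cases ?_ (fun j => ?_) j
      · simp
      · intro _
        simpa using hvx j
      · intro _
        simpa using inner_eq_zero_symm.mp (hvx i)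
      · intro hij
        have := hv.2 (show i ≠ j from fun h => hij (by rw [h]))
        simpa using this
    · exact Fin.cases (by simpa using hm0) fun i => by simpa using hs i
    · intro i j
      refine Fin.cases ?_ (fun i => ?_) i <;> refine Fin.cases ?_ (fun j => ?_) j
      · simpa using hm
      · simpa [(Fin.succ_ne_zero j).symm] using horth _ (hvx j)
      · simpa [hB (v i : E) x] using horth _ (hvx i)
      · simpa [LinearMap.domRestrict₁₂_apply] using hd i j

/-- **Autonne–Takagi factorization** of a complex symmetric matrix, with decreasing values. -/
theorem Matrix.exists_takagi {n : ℕ} (τ : Matrix (Fin n) (Fin n) ℂ) (hτ : τᵀ = τ) :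
    ∃ (X : Matrix (Fin n) (Fin n) ℂ) (s : Fin n → ℝ), Xᴴ * X = 1 ∧ (∀ i, 0 ≤ s i) ∧ Antitone s ∧
      Xᵀ * τ * X = diagonal fun i => (s i : ℂ) := by
  let e : EuclideanSpace ℂ (Fin n) ≃ₗ[ℂ] (Fin n → ℂ) := WithLp.linearEquiv 2 ℂ (Fin n → ℂ)
  obtain ⟨v, s, hv, hs, hd⟩ := exists_orthonormal_diagonalizing_symm_bilin n
    (E := EuclideanSpace ℂ (Fin n)) (by simp)
    ((Matrix.toLinearMap₂' ℂ τ).compl₁₂ e.toLinearMap e.toLinearMap)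
    (fun x y => by
      simp only [LinearMap.compl₁₂_apply, Matrix.toLinearMap₂'_apply']
      rw [Matrix.dotProduct_mulVec, ← Matrix.mulVec_transpose, hτ, dotProduct_comm])
  let σ : Equiv.Perm (Fin n) := Fin.revPerm.trans (Tuple.sort s)
  refine ⟨Matrix.of fun i j => v (σ j) i, fun i => s (σ i), ?_, fun i => hs _, ?_, ?_⟩
  · ext i j
    have h := orthonormal_iff_ite.mp hv (σ i) (σ j)
    simp only [PiLp.inner_apply, RCLike.inner_apply, EmbeddingLike.apply_eq_iff_eq] at h
    rw [Matrix.mul_apply, Matrix.one_apply, ← h]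
    exact Finset.sum_congr rfl fun k _ => by simp [mul_comm]
  · intro i j hij
    exact Tuple.monotone_sort s (Fin.rev_le_rev.mpr hij)
  · ext i j
    have h := hd (σ i) (σ j)
    simp only [LinearMap.compl₁₂_apply, Matrix.toLinearMap₂'_apply'] at h
    rw [Matrix.mul_assoc, diagonal_apply]
    simp only [EmbeddingLike.apply_eq_iff_eq] at h
    rw [← h, Matrix.mul_apply]
    rfl

/-! ### Eigenvalue and trace inequalities -/

/-- Unitary diagonalization of a Hermitian matrix with decreasing eigenvalues. -/
theorem Matrix.IsHermitian.exists_antitone_diagonalization {n : ℕ} {A : Matrix (Fin n) (Fin n) ℂ}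
    (hA : A.IsHermitian) :
    ∃ (P : Matrix (Fin n) (Fin n) ℂ) (μ : Fin n → ℝ), Pᴴ * P = 1 ∧ Antitone μ ∧
      A = P * (diagonal fun i => (μ i : ℂ)) * Pᴴ := by
  let σ : Equiv.Perm (Fin n) := Fin.revPerm.trans (Tuple.sort hA.eigenvalues)
  have hU : (hA.eigenvectorUnitary : Matrix (Fin n) (Fin n) ℂ)ᴴ * hA.eigenvectorUnitary = 1 :=
    Unitary.coe_star_mul_self hA.eigenvectorUnitary
  refine ⟨(hA.eigenvectorUnitary : Matrix (Fin n) (Fin n) ℂ).submatrix id σ,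
    fun i => hA.eigenvalues (σ i), ?_, ?_, ?_⟩
  · rw [conjTranspose_submatrix, submatrix_mul _ _ _ _ _ Function.bijective_id |>.symm, hU]
    simp
  · intro i j hij
    exact Tuple.monotone_sort hA.eigenvalues (Fin.rev_le_rev.mpr hij)
  · have h1 : (diagonal fun i => (hA.eigenvalues (σ i) : ℂ)) =
        (diagonal fun i => (hA.eigenvalues i : ℂ)).submatrix σ σ :=
      (submatrix_diagonal_equiv (fun i => (hA.eigenvalues i : ℂ)) σ).symm
    rw [conjTranspose_submatrix, h1, ← submatrix_mul _ _ _ _ _ σ.bijective,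
      ← submatrix_mul _ _ _ _ _ σ.bijective, submatrix_id_id]
    exact hA.spectral_theorem

/-- The rearrangement inequality for doubly stochastic matrices. -/
theorem sum_mul_rev_le_of_mem_doublyStochastic {n : ℕ} {l μ : Fin n → ℝ} (hl : Antitone l)
    (hμ : Antitone μ) {Q : Matrix (Fin n) (Fin n) ℝ} (hQ : Q ∈ doublyStochastic ℝ (Fin n)) :
    ∑ i, l i * μ i.rev ≤ ∑ i, l i * ∑ j, μ j * Q i j := by
  -- By Birkhoff's theorem, and since the bound is affine in `Q`, only permutation matrices matter;
  -- there it is the classical rearrangement inequality.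
  have hQ' : Q ∈ convexHull ℝ {x | ∃ σ, Equiv.Perm.permMatrix ℝ σ = x} := by
    rw [← doublyStochastic_eq_convexHull_permMatrix]
    exact hQ
  refine convexHull_min (t := {Q : Matrix (Fin n) (Fin n) ℝ |
    ∑ i, l i * μ i.rev ≤ ∑ i, l i * ∑ j, μ j * Q i j}) ?_ ?_ hQ'
  · rintro _ ⟨σ, rfl⟩
    have h : Antivary l (fun i => μ i.rev) :=
      hl.antivary fun i j hij => hμ (Fin.rev_le_rev.mpr hij)
    have := h.sum_mul_le_sum_mul_comp_perm (σ := σ.trans Fin.revPerm)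
    simpa [Equiv.Perm.permMatrix, PEquiv.toMatrix_apply] using this
  · intro A hA B hB a b ha hb hab
    simp only [Set.mem_ofPred_eq] at hA hB ⊢
    have : ∑ i, l i * ∑ j, μ j * (a • A + b • B) i j =
        a * (∑ i, l i * ∑ j, μ j * A i j) + b * ∑ i, l i * ∑ j, μ j * B i j := by
      simp only [Finset.mul_sum, ← Finset.sum_add_distrib, Matrix.add_apply, Matrix.smul_apply,
        smul_eq_mul]
      exact Finset.sum_congr rfl fun i _ => Finset.sum_congr rfl fun j _ => by ring
    rw [this]
    calc ∑ i, l i * μ i.rev = a * (∑ i, l i * μ i.rev) + b * ∑ i, l i * μ i.rev := by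
          rw [← add_mul, hab, one_mul]
      _ ≤ _ := by gcongr

/-- The lower half of von Neumann's trace inequality for a diagonal and a Hermitian matrix. -/
theorem Matrix.sum_mul_rev_le_sum_mul_diag {n : ℕ} {l μ : Fin n → ℝ} (hl : Antitone l)
    (hμ : Antitone μ) {P : Matrix (Fin n) (Fin n) ℂ} (hP : Pᴴ * P = 1) :
    ∑ i, l i * μ i.rev ≤
      ∑ i, l i * ((P * (diagonal fun i => (μ i : ℂ)) * Pᴴ) i i).re := by
  have hP' : P * Pᴴ = 1 := mul_eq_one_comm.mp hP
  have h1 : ∀ i, ((P * (diagonal fun i => (μ i : ℂ)) * Pᴴ) i i).re =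
      ∑ j, μ j * Complex.normSq (P i j) := by
    intro i
    rw [Matrix.mul_apply, Complex.re_sum]
    refine Finset.sum_congr rfl fun j _ => ?_
    rw [mul_diagonal, conjTranspose_apply, mul_right_comm, Complex.star_def, Complex.mul_conj,
      mul_comm, ← Complex.ofReal_mul, Complex.ofReal_re]
  simp only [h1]
  -- The squared moduli of the entries of a unitary matrix are doubly stochastic.
  refine sum_mul_rev_le_of_mem_doublyStochastic hl hμ
    (Q := Matrix.of fun i j => Complex.normSq (P i j)) ?_
  rw [mem_doublyStochastic_iff_sum]
  refine ⟨fun i j => Complex.normSq_nonneg _, fun i => ?_, fun j => ?_⟩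
  · have := congrFun (congrFun hP' i) i
    simp only [Matrix.mul_apply, conjTranspose_apply, Complex.star_def, Complex.mul_conj,
      one_apply_eq] at this
    exact_mod_cast this
  · have := congrFun (congrFun hP j) j
    simp only [Matrix.mul_apply, conjTranspose_apply, Complex.star_def, mul_comm (starRingEnd ℂ _),
      Complex.mul_conj, one_apply_eq] at this
    exact_mod_cast this

/-- If a Hermitian `4 × 4` matrix is isospectral with its inverse and has exactly one negative
eigenvalue, its spectrum has the form `a, 1, a⁻¹, -1`. -/
theorem Matrix.eigenvalues_of_isospectral_inv {P W' : Matrix (Fin 4) (Fin 4) ℂ} {μ : Fin 4 → ℝ}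
    (hP : Pᴴ * P = 1) (hμ : Antitone μ)
    (hW : (P * (diagonal fun i => (μ i : ℂ)) * Pᴴ) * W' = 1)
    (hc : W'.charpoly = (P * (diagonal fun i => (μ i : ℂ)) * Pᴴ).charpoly)
    (h2 : 0 < μ 2) (h3 : μ 3 < 0) : μ 0 * μ 2 = 1 ∧ μ 1 = 1 ∧ μ 3 = -1 := by
  have hP' : P * Pᴴ = 1 := mul_eq_one_comm.mp hP
  have h12 : μ 2 ≤ μ 1 := hμ (by decide)
  have h01 : μ 1 ≤ μ 0 := hμ (by decide)
  have hne : ∀ i, μ i ≠ 0 := by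
    intro i
    fin_cases i
    · exact (h2.trans_le (h12.trans h01)).ne'
    · exact (h2.trans_le h12).ne'
    · exact h2.ne'
    · exact h3.ne
  have hconj : ∀ D : Matrix (Fin 4) (Fin 4) ℂ, (P * D * Pᴴ).charpoly = D.charpoly := by
    intro D
    rw [Matrix.charpoly_mul_comm, ← Matrix.mul_assoc, hP, Matrix.one_mul]
  have hW' : W' = P * (diagonal fun i => ((μ i)⁻¹ : ℂ)) * Pᴴ := by
    have h : (P * (diagonal fun i => ((μ i)⁻¹ : ℂ)) * Pᴴ) *
        (P * (diagonal fun i => (μ i : ℂ)) * Pᴴ) = 1 := by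
      calc _ = P * (diagonal fun i => ((μ i)⁻¹ : ℂ)) * (Pᴴ * P) *
            (diagonal fun i => (μ i : ℂ)) * Pᴴ := by simp only [Matrix.mul_assoc]
        _ = P * ((diagonal fun i => ((μ i)⁻¹ : ℂ)) * (diagonal fun i => (μ i : ℂ))) * Pᴴ := by
          rw [hP, Matrix.mul_one]; simp only [Matrix.mul_assoc]
        _ = 1 := by
          rw [diagonal_mul_diagonal]
          simp [hne, hP']
    exact (left_inv_eq_right_inv h hW).symm
  rw [hW', hconj, hconj, charpoly_diagonal, charpoly_diagonal] at hc
  have hroots := congrArg Polynomial.roots hc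
  have hprod : ∀ f : Fin 4 → ℂ, (∏ i, (Polynomial.X - Polynomial.C (f i))).roots =
      Finset.univ.val.map f := by
    intro f
    have := Polynomial.roots_multiset_prod_X_sub_C (Finset.univ.val.map f)
    rwa [Multiset.map_map] at this
  rw [hprod, hprod] at hroots
  have hroots' : Finset.univ.val.map (fun i => (μ i)⁻¹) = Finset.univ.val.map μ := by
    apply Multiset.map_injective Complex.ofReal_injective
    simpa [Multiset.map_map, Function.comp_def] using hroots
  have hl : ∀ f : Fin 4 → ℝ,
      Finset.univ.val.map f = (([f 0, f 1, f 2, f 3] : List ℝ) : Multiset ℝ) := fun f => rfl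
  rw [hl, hl] at hroots'
  -- Inversion reverses the three positive eigenvalues and leaves the negative one last. Both lists
  -- are then decreasing, so being permutations of each other they coincide entry by entry.
  have hperm : [(μ 2)⁻¹, (μ 1)⁻¹, (μ 0)⁻¹, (μ 3)⁻¹].Perm [μ 0, μ 1, μ 2, μ 3] := by
    refine List.Perm.trans ?_ (Multiset.coe_eq_coe.mp hroots')
    exact ((List.reverse_perm [(μ 0)⁻¹, (μ 1)⁻¹, (μ 2)⁻¹]).append_right [(μ 3)⁻¹])
  have p1 := h2.trans_le h12
  have p0 := p1.trans_le h01
  have i12 : (μ 1)⁻¹ ≤ (μ 2)⁻¹ := inv_anti₀ h2 h12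
  have i01 : (μ 0)⁻¹ ≤ (μ 1)⁻¹ := inv_anti₀ p1 h01
  have i0 : 0 < (μ 0)⁻¹ := inv_pos.mpr p0
  have i3 : (μ 3)⁻¹ < 0 := inv_lt_zero.mpr h3
  have heq := hperm.eq_of_pairwise (le := (· ≥ ·)) (fun a b _ _ h h' => le_antisymm h' h)
    (by simp; refine ⟨⟨?_, ?_, ?_⟩, ⟨?_, ?_⟩, ?_⟩ <;> linarith)
    (by simp; refine ⟨⟨?_, ?_, ?_⟩, ⟨?_, ?_⟩, ?_⟩ <;> linarith)
  simp only [List.cons.injEq, and_true] at heq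
  obtain ⟨e0, e1, -, e3⟩ := heq
  refine ⟨?_, ?_, ?_⟩
  · rw [← e0]; field_simp
  · have : μ 1 * μ 1 = 1 := by nth_rewrite 1 [← e1]; field_simp
    nlinarith
  · have : μ 3 * μ 3 = 1 := by nth_rewrite 1 [← e3]; exact inv_mul_cancel₀ h3.ne
    nlinarith

theorem Matrix.conjTranspose_mul_diagonal_mul_apply_self {m n : Type*} [Fintype m]
    [DecidableEq m] (Z : Matrix m n ℂ) (d : m → ℝ) (i : n) :
    (Zᴴ * (diagonal fun j => (d j : ℂ)) * Z) i i =
      ((∑ j, d j * Complex.normSq (Z j i) : ℝ) : ℂ) := by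
  rw [Matrix.mul_apply, Complex.ofReal_sum]
  refine Finset.sum_congr rfl fun j _ => ?_
  rw [mul_diagonal, conjTranspose_apply, Complex.star_def, Complex.ofReal_mul,
    Complex.normSq_eq_conj_mul_self]
  ring

/-- Sylvester's law for a form congruent to `diag(-1, 1, 1, 1)`: the second least eigenvalue is
positive and the least one is negative. -/
theorem Matrix.eigenvalues_of_lorentzian_congruence {Z Y : Matrix (Fin 4) (Fin 4) ℂ}
    {μ : Fin 4 → ℝ} (hμ : Antitone μ) (hYZ : Y * Z = 1)
    (h : (diagonal fun i => (μ i : ℂ)) =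
      Zᴴ * (diagonal fun i => ((![-1, 1, 1, 1] : Fin 4 → ℝ) i : ℂ)) * Z) :
    0 < μ 2 ∧ μ 3 < 0 := by
  have hZY : Z * Y = 1 := mul_eq_one_comm.mp hYZ
  have h23 : μ 3 ≤ μ 2 := hμ (by decide)
  have h13 : μ 3 ≤ μ 1 := hμ (by decide)
  have h03 : μ 3 ≤ μ 0 := hμ (by decide)
  constructor
  · by_contra! h2
    -- If `μ 2 ≤ 0`, the form is nonpositive on the plane of the last two coordinates. Some nonzero
    -- vector of that plane is sent by `Z` into the hyperplane where the Lorentzian form is positive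
    -- definite.
    obtain ⟨α, β, hne, h0⟩ : ∃ α β : ℂ, (α ≠ 0 ∨ β ≠ 0) ∧ Z 0 2 * α + Z 0 3 * β = 0 := by
      by_cases hz : Z 0 2 = 0
      · exact ⟨1, 0, by simp, by simp [hz]⟩
      · exact ⟨Z 0 3, -Z 0 2, by simp [hz], by ring⟩
    let y : Matrix (Fin 4) (Fin 1) ℂ := Matrix.of fun i _ => (![0, 0, α, β] : Fin 4 → ℂ) i
    have e : yᴴ * (diagonal fun i => (μ i : ℂ)) * y =
        (Z * y)ᴴ * (diagonal fun i => ((![-1, 1, 1, 1] : Fin 4 → ℝ) i : ℂ)) * (Z * y) := by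
      rw [h, conjTranspose_mul]
      simp only [Matrix.mul_assoc]
    have e' := congrFun (congrFun e 0) 0
    rw [conjTranspose_mul_diagonal_mul_apply_self, conjTranspose_mul_diagonal_mul_apply_self,
      Complex.ofReal_inj] at e'
    have hz0 : (Z * y) 0 0 = 0 := by
      simpa [Matrix.mul_apply, Fin.sum_univ_four, y] using h0
    simp only [Fin.sum_univ_four] at e'
    rw [hz0] at e'
    simp [y] at e'
    have q1 := mul_nonneg (neg_nonneg.mpr h2) (Complex.normSq_nonneg α)
    have q2 := mul_nonneg (neg_nonneg.mpr (h23.trans h2)) (Complex.normSq_nonneg β)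
    have n1 := Complex.normSq_nonneg ((Z * y) 1 0)
    have n2 := Complex.normSq_nonneg ((Z * y) 2 0)
    have n3 := Complex.normSq_nonneg ((Z * y) 3 0)
    have z1 : (Z * y) 1 0 = 0 := Complex.normSq_eq_zero.mp (by simp only [y]; linarith)
    have z2 : (Z * y) 2 0 = 0 := Complex.normSq_eq_zero.mp (by simp only [y]; linarith)
    have z3 : (Z * y) 3 0 = 0 := Complex.normSq_eq_zero.mp (by simp only [y]; linarith)
    have hZy : Z * y = 0 := by
      ext i j
      fin_cases j
      fin_cases i <;> assumption
    have hy : y = 0 := by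
      rw [← Matrix.one_mul y, ← hYZ, Matrix.mul_assoc, hZy, Matrix.mul_zero]
    have y2 : α = 0 := congrFun (congrFun hy 2) 0
    have y3 : β = 0 := congrFun (congrFun hy 3) 0
    tauto
  · by_contra! h3
    have e : Yᴴ * (diagonal fun i => (μ i : ℂ)) * Y =
        diagonal fun i => ((![-1, 1, 1, 1] : Fin 4 → ℝ) i : ℂ) := by
      calc _ = (Z * Y)ᴴ * (diagonal fun i => ((![-1, 1, 1, 1] : Fin 4 → ℝ) i : ℂ)) * (Z * Y) := by
            rw [h, conjTranspose_mul]
            simp only [Matrix.mul_assoc]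
        _ = _ := by rw [hZY, conjTranspose_one, Matrix.one_mul, Matrix.mul_one]
    have e' := congrFun (congrFun e 0) 0
    rw [conjTranspose_mul_diagonal_mul_apply_self, diagonal_apply_eq, Complex.ofReal_inj] at e'
    have : 0 ≤ ∑ j, μ j * Complex.normSq (Y j 0) := by
      refine Finset.sum_nonneg fun j _ => mul_nonneg ?_ (Complex.normSq_nonneg _)
      fin_cases j
      · exact h3.trans h03
      · exact h3.trans h13
      · exact h3.trans h23
      · exact h3
    rw [e'] at this
    norm_num at this

/-! ### Wootters' numbers and the spectral inequality -/

/-- A diagonal positive matrix is of the form `G S Gᴴ` with `S` diagonal, positive and decreasing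
and `G` orthogonal for a given nondegenerate symmetric bilinear form `V`. -/
theorem Matrix.exists_orthogonal_congruence_diagonal {n : ℕ} {V : Matrix (Fin n) (Fin n) ℂ}
    {l : Fin n → ℝ} (hVt : Vᵀ = V) (hV : Vᴴ * V = 1) (hpos : ∀ i, 0 < l i) :
    ∃ (G : Matrix (Fin n) (Fin n) ℂ) (s : Fin n → ℝ), (∀ i, 0 < s i) ∧ Antitone s ∧
      Gᵀ * V * G = 1 ∧
      G * (diagonal fun i => (s i : ℂ)) * Gᴴ = diagonal fun i => (l i : ℂ) := by
  let L : Matrix (Fin n) (Fin n) ℂ := diagonal fun i => ((√(l i) : ℝ) : ℂ)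
  have hLt : Lᵀ = L := diagonal_transpose _
  have hLh : Lᴴ = L := by simp [L, diagonal_conjTranspose, Pi.star_def]
  have hLL : L * L = diagonal fun i => (l i : ℂ) := by
    simp only [L, diagonal_mul_diagonal]
    congr 1
    ext i
    rw [← Complex.ofReal_mul, Real.mul_self_sqrt (hpos i).le]
  obtain ⟨X, s, hX, hs0, hs, hτ⟩ := Matrix.exists_takagi (L * V * L)
    (by simp only [transpose_mul, hLt, hVt, Matrix.mul_assoc])
  have hs' : ∀ i, 0 < s i := by
    have hdet := congrArg Matrix.det hτ
    have h1 := congrArg Matrix.det hX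
    have h2 := congrArg Matrix.det hV
    simp only [det_mul, det_transpose, det_one, det_diagonal] at hdet h1 h2
    have h3 : L.det ≠ 0 := by
      rw [det_diagonal, Finset.prod_ne_zero_iff]
      intro i _
      exact_mod_cast (Real.sqrt_pos.mpr (hpos i)).ne'
    have h4 : ∏ i, (s i : ℂ) ≠ 0 := by
      rw [← hdet]
      have := right_ne_zero_of_mul_eq_one h1
      have := right_ne_zero_of_mul_eq_one h2
      positivity
    rw [Finset.prod_ne_zero_iff] at h4
    intro i
    exact lt_of_le_of_ne (hs0 i) fun h => h4 i (Finset.mem_univ _) (by rw [← h]; simp)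
  -- `T = S^{-1/2}` turns the Takagi form `S` into the identity.
  let T : Matrix (Fin n) (Fin n) ℂ := diagonal fun i => (((√(s i))⁻¹ : ℝ) : ℂ)
  have hTt : Tᵀ = T := diagonal_transpose _
  have hTh : Tᴴ = T := by simp [T, diagonal_conjTranspose, Pi.star_def]
  have hTST : T * (diagonal fun i => (s i : ℂ)) * T = 1 := by
    simp only [T, diagonal_mul_diagonal]
    rw [← diagonal_one]
    congr 1
    ext i
    have h := Real.mul_self_sqrt (hs' i).le
    have h' : √(s i) ≠ 0 := (Real.sqrt_pos.mpr (hs' i)).ne'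
    norm_cast
    field_simp
    linarith
  refine ⟨L * X * T, s, hs', hs, ?_, ?_⟩
  · calc (L * X * T)ᵀ * V * (L * X * T) = T * (Xᵀ * (L * V * L) * X) * T := by
          simp only [transpose_mul, hLt, hTt, Matrix.mul_assoc]
      _ = 1 := by rw [hτ, hTST]
  · calc L * X * T * (diagonal fun i => (s i : ℂ)) * (L * X * T)ᴴ =
          L * X * (T * (diagonal fun i => (s i : ℂ)) * T) * Xᴴ * L := by
          simp only [conjTranspose_mul, hLh, hTh, Matrix.mul_assoc]
      _ = L * (X * Xᴴ) * L := by rw [hTST, Matrix.mul_one]; simp only [Matrix.mul_assoc]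
      _ = _ := by rw [mul_eq_one_comm.mp hX, Matrix.mul_one, hLL]

/-- Wootters' separability condition holds for every spectrum with `λ₁ - λ₃ ≤ 2 √(λ₂ λ₄)`,
whatever the eigenbasis, which enters through the symmetric unitary matrix `V`. -/
theorem Matrix.orthogonal_congruence_value_le {V G : Matrix (Fin 4) (Fin 4) ℂ} {l s : Fin 4 → ℝ}
    (hVt : Vᵀ = V) (hV : Vᴴ * V = 1) (hl : Antitone l) (hpos : ∀ i, 0 < l i)
    (hcrit : l 0 - l 2 ≤ 2 * Real.sqrt (l 1 * l 3)) (hG : Gᵀ * V * G = 1)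
    (hGl : G * (diagonal fun i => (s i : ℂ)) * Gᴴ = diagonal fun i => (l i : ℂ)) :
    s 0 ≤ s 1 + s 2 + s 3 := by
  let D : Matrix (Fin 4) (Fin 4) ℂ := diagonal fun i => ((![-1, 1, 1, 1] : Fin 4 → ℝ) i : ℂ)
  have hDt : Dᵀ = D := diagonal_transpose _
  have hDh : Dᴴ = D := by simp [D, diagonal_conjTranspose, Pi.star_def]
  have hDD : D * D = 1 := by
    simp only [D, diagonal_mul_diagonal]
    rw [← diagonal_one]
    congr 1
    ext i
    fin_cases i <;> simp
  let K := Gᵀ * V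
  have hKG : K * G = 1 := hG
  have hGK : G * K = 1 := mul_eq_one_comm.mp hKG
  let W := Kᴴ * D * K
  have hW : W.IsHermitian := by
    simp only [W, IsHermitian, conjTranspose_mul, hDh, conjTranspose_conjTranspose,
      Matrix.mul_assoc]
  obtain ⟨P, μ, hP, hμ, hWP⟩ := hW.exists_antitone_diagonalization
  obtain ⟨h2, h3⟩ := Matrix.eigenvalues_of_lorentzian_congruence (Z := K * P) (Y := Pᴴ * G) hμ
    (by rw [Matrix.mul_assoc, ← Matrix.mul_assoc G, hGK, Matrix.one_mul, hP])
    (by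
      calc (diagonal fun i => (μ i : ℂ)) = Pᴴ * P * (diagonal fun i => (μ i : ℂ)) * (Pᴴ * P) := by
            rw [hP, Matrix.one_mul, Matrix.mul_one]
        _ = Pᴴ * (P * (diagonal fun i => (μ i : ℂ)) * Pᴴ) * P := by simp only [Matrix.mul_assoc]
        _ = Pᴴ * (Kᴴ * D * K) * P := by rw [← hWP]
        _ = _ := by simp only [D, conjTranspose_mul, Matrix.mul_assoc])
  have hinv : W * (G * D * Gᴴ) = 1 := by
    calc W * (G * D * Gᴴ) = Kᴴ * (D * (K * G) * D) * Gᴴ := by simp only [W, Matrix.mul_assoc]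
      _ = (G * K)ᴴ := by rw [hKG, Matrix.mul_one, hDD, Matrix.mul_one, conjTranspose_mul G K]
      _ = 1 := by rw [hGK, conjTranspose_one]
  -- `G D Gᴴ` is the inverse of `W`, and the unitary `V` conjugates it to `Wᵀ`; hence `W` is
  -- isospectral with its inverse.
  have hchar : (G * D * Gᴴ).charpoly = W.charpoly := by
    have hKt : Kᵀ = V * G := by rw [transpose_mul, hVt, transpose_transpose]
    have hWt : Wᵀ = V * (G * D * Gᴴ) * Vᴴ := by
      have : Kᴴᵀ = Gᴴ * Vᴴ := by
        rw [show Kᴴᵀ = Kᵀᴴ from rfl, hKt, conjTranspose_mul]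
      simp only [W, transpose_mul, hDt, this, hKt, Matrix.mul_assoc]
    rw [← charpoly_transpose W, hWt, charpoly_mul_comm (V * (G * D * Gᴴ)), ← Matrix.mul_assoc, hV,
      Matrix.one_mul]
  obtain ⟨e0, e1, e3⟩ := Matrix.eigenvalues_of_isospectral_inv hP hμ (hWP ▸ hinv)
    (hchar.trans (by rw [← hWP])) h2 h3
  have htr : ∑ i, l i * (W i i).re = -s 0 + s 1 + s 2 + s 3 := by
    have h1 : (W * diagonal fun i => (l i : ℂ)).trace = (D * diagonal fun i => (s i : ℂ)).trace := by
      calc _ = (Kᴴ * (D * (K * G) * (diagonal fun i => (s i : ℂ)) * Gᴴ)).trace := by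
            rw [← hGl]
            simp only [W, Matrix.mul_assoc]
        _ = (D * (diagonal fun i => (s i : ℂ)) * (K * G)ᴴ).trace := by
            rw [conjTranspose_mul K G, trace_mul_comm, hKG, Matrix.mul_one, Matrix.mul_assoc]
        _ = _ := by rw [hKG, conjTranspose_one, Matrix.mul_one]
    have h2 := congrArg Complex.re h1
    simp only [D, trace, diag_apply, mul_diagonal, diagonal_apply_eq, Complex.re_sum,
      Complex.re_mul_ofReal] at h2
    simp only [Fin.sum_univ_four] at h2 ⊢
    simp at h2
    linarith
  have hmain := Matrix.sum_mul_rev_le_sum_mul_diag hl hμ hP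
  rw [← hWP, htr] at hmain
  simp only [Fin.sum_univ_four] at hmain
  have hr : Fin.rev (0 : Fin 4) = 3 ∧ Fin.rev (1 : Fin 4) = 2 ∧ Fin.rev (2 : Fin 4) = 1 ∧
      Fin.rev (3 : Fin 4) = 0 := by decide
  rw [hr.1, hr.2.1, hr.2.2.1, hr.2.2.2, e1, e3] at hmain
  have h0 : 0 < μ 0 := pos_of_mul_pos_left (e0 ▸ one_pos) h2.le
  -- Arithmetic–geometric mean, using `μ 0 * μ 2 = 1`.
  have hsq : Real.sqrt (l 1 * l 3) ≤ (l 1 * μ 2 + l 3 * μ 0) / 2 := by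
    have p1 := mul_pos (hpos 1) h2
    have p3 := mul_pos (hpos 3) h0
    apply Real.sqrt_le_iff.mpr ⟨by positivity, ?_⟩
    have : l 1 * l 3 = (l 1 * μ 2) * (l 3 * μ 0) := by
      linear_combination (-(l 1 * l 3)) * e0
    rw [this]
    nlinarith [sq_nonneg (l 1 * μ 2 - l 3 * μ 0)]
  linarith

/-! ### The separable cone -/

/-- The cone of unnormalized separable states. -/
def separableCone (m n : Type*) [Fintype m] [Fintype n] : Set (Matrix (m × n) (m × n) ℂ) :=
  {M | M = 0 ∨ ∃ c : ℝ, 0 < c ∧ ∃ σ ∈ separableStates m n, M = c • σ}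

section separableCone

variable {m n : Type*} [Fintype m] [Fintype n]

theorem separableCone.add_mem {M N : Matrix (m × n) (m × n) ℂ} (hM : M ∈ separableCone m n)
    (hN : N ∈ separableCone m n) : M + N ∈ separableCone m n := by
  rcases hM with rfl | ⟨c, hc, σ, hσ, rfl⟩
  · simpa using hN
  rcases hN with rfl | ⟨d, hd, τ, hτ, rfl⟩
  · exact Or.inr ⟨c, hc, σ, hσ, by simp⟩
  · refine Or.inr ⟨c + d, by positivity, (c / (c + d)) • σ + (d / (c + d)) • τ,
      convex_convexHull ℝ _ hσ hτ (by positivity) (by positivity) (by field_simp), ?_⟩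
    rw [smul_add, smul_smul, smul_smul, mul_div_cancel₀ _ (by positivity),
      mul_div_cancel₀ _ (by positivity)]

theorem separableCone.smul_mem {M : Matrix (m × n) (m × n) ℂ} (hM : M ∈ separableCone m n)
    {c : ℝ} (hc : 0 ≤ c) : c • M ∈ separableCone m n := by
  rcases hc.eq_or_lt with rfl | hc
  · exact Or.inl (zero_smul _ _)
  rcases hM with rfl | ⟨d, hd, τ, hτ, rfl⟩
  · exact Or.inl (smul_zero _)
  · exact Or.inr ⟨c * d, by positivity, τ, hτ, smul_smul _ _ _⟩

theorem trace_eq_one_of_mem_separableStates {σ : Matrix (m × n) (m × n) ℂ}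
    (hσ : σ ∈ separableStates m n) : σ.trace = 1 := by
  refine convexHull_min (t := {σ : Matrix (m × n) (m × n) ℂ | σ.trace = 1}) ?_ ?_ hσ
  · rintro _ ⟨A, hA, B, hB, rfl⟩
    simp [trace_kronecker, hA.2, hB.2]
  · intro x hx y hy a b _ _ hab
    simp only [Set.mem_ofPred_eq] at hx hy ⊢
    rw [trace_add, trace_smul, trace_smul, hx, hy, ← add_smul, hab, one_smul]

theorem separableCone.mem_separableStates {M : Matrix (m × n) (m × n) ℂ}
    (hM : M ∈ separableCone m n) (htr : M.trace = 1) : M ∈ separableStates m n := by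
  rcases hM with rfl | ⟨d, hd, τ, hτ, rfl⟩
  · simp at htr
  · rw [trace_smul, trace_eq_one_of_mem_separableStates hτ] at htr
    have : d = 1 := by simpa using htr
    rwa [this, one_smul]

theorem Matrix.trace_vecMulVec_star (u : n → ℂ) :
    (vecMulVec u (star u)).trace = ((∑ i, Complex.normSq (u i) : ℝ) : ℂ) := by
  simp [trace_vecMulVec, dotProduct, Complex.mul_conj]

theorem vecMulVec_eq_smul_densityMatrix (u : n → ℂ) :
    vecMulVec u (star u) = 0 ∨
      ∃ c : ℝ, 0 < c ∧ ∃ A ∈ densityMatrices n, vecMulVec u (star u) = c • A := by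
  rcases eq_or_ne u 0 with rfl | hu
  · exact Or.inl (by simp)
  have hc : 0 < ∑ i, Complex.normSq (u i) := by
    obtain ⟨i, hi⟩ := Function.ne_iff.mp hu
    exact Finset.sum_pos' (fun _ _ => Complex.normSq_nonneg _)
      ⟨i, Finset.mem_univ _, Complex.normSq_pos.mpr hi⟩
  refine Or.inr ⟨_, hc, (∑ i, Complex.normSq (u i))⁻¹ • vecMulVec u (star u), ⟨?_, ?_⟩, ?_⟩
  · exact (posSemidef_vecMulVec_self_star u).smul (inv_nonneg.mpr hc.le)
  · rw [trace_smul, Matrix.trace_vecMulVec_star, Complex.real_smul, ← Complex.ofReal_mul,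
      inv_mul_cancel₀ hc.ne', Complex.ofReal_one]
  · rw [smul_smul, mul_inv_cancel₀ hc.ne', one_smul]

theorem vecMulVec_mem_separableCone_of_product (u : m → ℂ) (w : n → ℂ) {p : m × n → ℂ}
    (hp : ∀ i, p i = u i.1 * w i.2) : vecMulVec p (star p) ∈ separableCone m n := by
  have h : vecMulVec p (star p) = vecMulVec u (star u) ⊗ₖ vecMulVec w (star w) := by
    ext i j
    simp only [vecMulVec_apply, kroneckerMap_apply, hp, Pi.star_apply, star_mul']
    ring
  rw [h]
  rcases vecMulVec_eq_smul_densityMatrix u with h0 | ⟨c, hc, A, hA, hA'⟩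
  · exact Or.inl (by rw [h0, zero_kronecker])
  rcases vecMulVec_eq_smul_densityMatrix w with h0 | ⟨d, hd, B, hB, hB'⟩
  · exact Or.inl (by rw [h0, kronecker_zero])
  · refine Or.inr ⟨c * d, by positivity, A ⊗ₖ B, subset_convexHull ℝ _ ⟨A, hA, B, hB, rfl⟩, ?_⟩
    rw [hA', hB', smul_kronecker, kronecker_smul, smul_smul]

end separableCone

/-! ### The spin-flip form and sufficiency of the criterion -/

/-- A two-qubit vector with vanishing determinant is a product vector. -/
theorem exists_product_of_det_eq_zero {p : Fin 2 × Fin 2 → ℂ}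
    (hp : p (0, 0) * p (1, 1) = p (0, 1) * p (1, 0)) :
    ∃ u w : Fin 2 → ℂ, ∀ i, p i = u i.1 * w i.2 := by
  by_cases h0 : p (0, 0) = 0
  · rw [h0, zero_mul, eq_comm, mul_eq_zero] at hp
    rcases hp with h | h
    · refine ⟨![0, 1], ![p (1, 0), p (1, 1)], ?_⟩
      rintro ⟨a, b⟩
      fin_cases a <;> fin_cases b <;> simp [h0, h]
    · refine ⟨![p (0, 1), p (1, 1)], ![0, 1], ?_⟩
      rintro ⟨a, b⟩
      fin_cases a <;> fin_cases b <;> simp [h0, h]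
  · refine ⟨![p (0, 0), p (1, 0)], ![1, p (0, 1) / p (0, 0)], ?_⟩
    rintro ⟨a, b⟩
    fin_cases a <;> fin_cases b <;> simp <;> field_simp
    linear_combination hp

/-- The matrix of the polarization of `2 det` on `ℂ² ⊗ ℂ²`: the spin-flip matrix. -/
def spinFlip : Matrix (Fin 2 × Fin 2) (Fin 2 × Fin 2) ℂ :=
  !![0, 1; -1, 0] ⊗ₖ !![0, 1; -1, 0]

theorem spinFlip_transpose : spinFlipᵀ = spinFlip := by
  ext ⟨a, b⟩ ⟨c, d⟩
  fin_cases a <;> fin_cases b <;> fin_cases c <;> fin_cases d <;> simp [spinFlip]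

theorem spinFlip_conjTranspose_mul : spinFlipᴴ * spinFlip = 1 := by
  have h : (!![0, 1; -1, 0] : Matrix (Fin 2) (Fin 2) ℂ)ᴴ * !![0, 1; -1, 0] = 1 := by
    ext i j
    fin_cases i <;> fin_cases j <;> simp [Matrix.mul_apply]
  rw [spinFlip, conjTranspose_kronecker, ← mul_kronecker_mul, h, one_kronecker_one]

theorem dotProduct_spinFlip_mulVec (p : Fin 2 × Fin 2 → ℂ) :
    p ⬝ᵥ spinFlip *ᵥ p = 2 * (p (0, 0) * p (1, 1) - p (0, 1) * p (1, 0)) := by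
  simp [dotProduct, mulVec, spinFlip, Fintype.sum_prod_type]
  ring

theorem vecMulVec_mem_separableCone {p : Fin 2 × Fin 2 → ℂ} (hp : p ⬝ᵥ spinFlip *ᵥ p = 0) :
    vecMulVec p (star p) ∈ separableCone (Fin 2) (Fin 2) := by
  rw [dotProduct_spinFlip_mulVec, mul_eq_zero, sub_eq_zero] at hp
  obtain ⟨u, w, h⟩ := exists_product_of_det_eq_zero (hp.resolve_left two_ne_zero)
  exact vecMulVec_mem_separableCone_of_product u w h

/-- The sum of the projections on two vectors of a spin-flip orthonormal family is separable. -/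
theorem vecMulVec_add_vecMulVec_mem_separableCone {p q : Fin 2 × Fin 2 → ℂ}
    (hp : p ⬝ᵥ spinFlip *ᵥ p = 1) (hq : q ⬝ᵥ spinFlip *ᵥ q = 1)
    (hpq : p ⬝ᵥ spinFlip *ᵥ q = 0) :
    vecMulVec p (star p) + vecMulVec q (star q) ∈ separableCone (Fin 2) (Fin 2) := by
  have hqp : q ⬝ᵥ spinFlip *ᵥ p = 0 := by
    rw [dotProduct_mulVec, ← mulVec_transpose, spinFlip_transpose, dotProduct_comm, hpq]
  -- The vectors `p ± i q` are isotropic, hence product vectors. In the average of their projections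
  -- the cross terms cancel, leaving the required sum.
  have h : ∀ c : ℂ, c * c = -1 → (p + c • q) ⬝ᵥ spinFlip *ᵥ (p + c • q) = 0 := by
    intro c hc
    simp only [mulVec_add, mulVec_smul, dotProduct_add, add_dotProduct, dotProduct_smul,
      smul_dotProduct, hp, hq, hpq, hqp, smul_eq_mul]
    linear_combination hc
  have h1 := vecMulVec_mem_separableCone (h Complex.I Complex.I_mul_I)
  have h2 := vecMulVec_mem_separableCone (h (-Complex.I) (by simp))
  convert separableCone.smul_mem (separableCone.add_mem h1 h2) (c := 1 / 2) (by norm_num) using 1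
  ext i j
  simp [vecMulVec_apply]
  ring_nf
  simp

theorem mul_diagonal_mul_conjTranspose_eq_sum {m n : Type*} [Fintype n] [DecidableEq n]
    (V : Matrix m n ℂ) (s : n → ℝ) :
    V * (diagonal fun i => (s i : ℂ)) * Vᴴ =
      ∑ i, s i • vecMulVec (V.col i) (star (V.col i)) := by
  ext a b
  rw [Matrix.mul_apply, Matrix.sum_apply]
  refine Finset.sum_congr rfl fun i _ => ?_
  rw [mul_diagonal, Matrix.smul_apply, vecMulVec_apply, Complex.real_smul, conjTranspose_apply,
    col_apply, Pi.star_apply, col_apply]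
  ring

/-- A two-qubit operator of unit trace with positive spectrum `λ₁ ≥ λ₂ ≥ λ₃ ≥ λ₄` such that
`λ₁ - λ₃ ≤ 2 √(λ₂ λ₄)` is separable. -/
theorem mem_separableStates_of_spectrum {M : Matrix (Fin 2 × Fin 2) (Fin 4) ℂ} {l : Fin 4 → ℝ}
    (hM : Mᴴ * M = 1) (hl : Antitone l) (hpos : ∀ i, 0 < l i) (hsum : ∑ i, l i = 1)
    (hcrit : l 0 - l 2 ≤ 2 * Real.sqrt (l 1 * l 3)) :
    M * (diagonal fun i => (l i : ℂ)) * Mᴴ ∈ separableStates (Fin 2) (Fin 2) := by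
  have hM' : M * Mᴴ = 1 := (mul_eq_one_comm_of_card_eq _ _ _ (by simp)).mp hM
  have htr : (M * (diagonal fun i => (l i : ℂ)) * Mᴴ).trace = 1 := by
    rw [trace_mul_comm, ← Matrix.mul_assoc, hM, Matrix.one_mul, trace_diagonal]
    exact_mod_cast hsum
  have hVt : (Mᵀ * spinFlip * M)ᵀ = Mᵀ * spinFlip * M := by
    simp only [transpose_mul, spinFlip_transpose, transpose_transpose, Matrix.mul_assoc]
  have hV : (Mᵀ * spinFlip * M)ᴴ * (Mᵀ * spinFlip * M) = 1 := by
    have h : Mᵀᴴ * Mᵀ = 1 := by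
      have := congrArg Matrix.transpose hM'
      rwa [transpose_mul, transpose_one] at this
    calc _ = Mᴴ * (spinFlipᴴ * (Mᵀᴴ * Mᵀ) * spinFlip) * M := by
          simp only [conjTranspose_mul, Matrix.mul_assoc]
      _ = 1 := by
          rw [h, Matrix.mul_one, spinFlip_conjTranspose_mul, Matrix.mul_one, hM]
  obtain ⟨G, s, hs, hsa, hG, hGl⟩ := Matrix.exists_orthogonal_congruence_diagonal hVt hV hpos
  have hle := Matrix.orthogonal_congruence_value_le hVt hV hl hpos hcrit hG hGl
  apply separableCone.mem_separableStates _ htr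
  have hρ : M * (diagonal fun i => (l i : ℂ)) * Mᴴ =
      (M * G) * (diagonal fun i => (s i : ℂ)) * (M * G)ᴴ := by
    rw [← hGl]
    simp only [conjTranspose_mul, Matrix.mul_assoc]
  have horth : ∀ i j, (M * G).col i ⬝ᵥ spinFlip *ᵥ (M * G).col j = if i = j then 1 else 0 := by
    intro i j
    have h : (M * G)ᵀ * (spinFlip * (M * G)) = 1 := by
      rw [← hG]
      simp only [transpose_mul, Matrix.mul_assoc]
    rw [← one_apply, ← h]
    rfl
  have hpair : ∀ i j, i ≠ j → vecMulVec ((M * G).col i) (star ((M * G).col i)) +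
      vecMulVec ((M * G).col j) (star ((M * G).col j)) ∈ separableCone (Fin 2) (Fin 2) :=
    fun i j hij => vecMulVec_add_vecMulVec_mem_separableCone (by simp [horth]) (by simp [horth])
      (by simp [horth, hij])
  rw [hρ, mul_diagonal_mul_conjTranspose_eq_sum, Fin.sum_univ_four]
  have h01 : s 1 ≤ s 0 := hsa (by decide)
  have h12 : s 2 ≤ s 1 := hsa (by decide)
  have h23 : s 3 ≤ s 2 := hsa (by decide)
  -- The weights on the pairs `01, 02, 03, 12` are chosen so that those meeting index `i` add up to
  -- `s i`. The ordering makes the first three nonnegative, and `hle` the last.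
  have key := separableCone.add_mem (separableCone.add_mem (separableCone.add_mem
    (separableCone.smul_mem (hpair 0 1 (by decide))
      (c := (s 0 + s 1 - s 2 - s 3) / 2) (by linarith))
    (separableCone.smul_mem (hpair 0 2 (by decide))
      (c := (s 0 + s 2 - s 1 - s 3) / 2) (by linarith)))
    (separableCone.smul_mem (hpair 0 3 (by decide)) (hs 3).le))
    (separableCone.smul_mem (hpair 1 2 (by decide))
      (c := (s 1 + s 2 + s 3 - s 0) / 2) (by linarith))
  convert key using 1
  module

/-- The unitary matrix whose columns are the vectors of an orthonormal basis. -/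
noncomputable def basisMatrix (ψ : TwoQubitBasis) : Matrix (Fin 2 × Fin 2) (Fin 4) ℂ :=
  Matrix.of fun a i => ψ i a

theorem basisMatrix_conjTranspose_mul (ψ : TwoQubitBasis) :
    (basisMatrix ψ)ᴴ * basisMatrix ψ = 1 := by
  ext i j
  have h := orthonormal_iff_ite.mp ψ.orthonormal i j
  simp only [PiLp.inner_apply, RCLike.inner_apply] at h
  rw [Matrix.mul_apply, Matrix.one_apply, ← h]
  exact Finset.sum_congr rfl fun k _ => by simp [basisMatrix, mul_comm]

theorem spectralState_eq (ψ : TwoQubitBasis) (l : Fin 4 → ℝ) :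
    spectralState ψ l =
      basisMatrix ψ * (diagonal fun i => (l i : ℂ)) * (basisMatrix ψ)ᴴ := by
  rw [mul_diagonal_mul_conjTranspose_eq_sum]
  rfl

section spectral

variable {M : Matrix (Fin 2 × Fin 2) (Fin 4) ℂ} {l : Fin 4 → ℝ}

theorem mem_densityMatrices_of_spectrum (hM : Mᴴ * M = 1) (hpos : ∀ i, 0 ≤ l i)
    (hsum : ∑ i, l i = 1) :
    M * (diagonal fun i => (l i : ℂ)) * Mᴴ ∈ densityMatrices (Fin 2 × Fin 2) := by
  constructor
  · exact (PosSemidef.diagonal fun i => by simpa using hpos i).mul_mul_conjTranspose_same M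
  · rw [trace_mul_comm, ← Matrix.mul_assoc, hM, Matrix.one_mul, trace_diagonal]
    exact_mod_cast hsum

/-- The separability criterion sees only the spectrum, and `U * M` again has orthonormal columns. -/
theorem mem_AS_of_spectrum (hM : Mᴴ * M = 1) (hl : Antitone l) (hpos : ∀ i, 0 < l i)
    (hsum : ∑ i, l i = 1) (hcrit : l 0 - l 2 ≤ 2 * Real.sqrt (l 1 * l 3)) :
    M * (diagonal fun i => (l i : ℂ)) * Mᴴ ∈ AS := by
  refine ⟨mem_densityMatrices_of_spectrum hM (fun i => (hpos i).le) hsum, fun U hU => ?_⟩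
  have hU' : Uᴴ * U = 1 := mem_unitaryGroup_iff'.mp hU
  have h := mem_separableStates_of_spectrum (M := U * M)
    (by rw [conjTranspose_mul, Matrix.mul_assoc, ← Matrix.mul_assoc Uᴴ, hU', Matrix.one_mul, hM])
    hl hpos hsum hcrit
  convert h using 1
  simp only [conjTranspose_mul, star_eq_conjTranspose, Matrix.mul_assoc]

theorem rank_of_spectrum (hM : Mᴴ * M = 1) (hpos : ∀ i, 0 < l i) :
    (M * (diagonal fun i => (l i : ℂ)) * Mᴴ).rank = 4 := by
  have hM' : M * Mᴴ = 1 := (mul_eq_one_comm_of_card_eq _ _ _ (by simp)).mp hM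
  have h : (M * (diagonal fun i => (l i : ℂ)) * Mᴴ) *
      (M * (diagonal fun i => ((l i)⁻¹ : ℂ)) * Mᴴ) = 1 := by
    calc _ = M * ((diagonal fun i => (l i : ℂ)) * (Mᴴ * M) *
          (diagonal fun i => ((l i)⁻¹ : ℂ))) * Mᴴ := by simp only [Matrix.mul_assoc]
      _ = 1 := by
        rw [hM, Matrix.mul_one, diagonal_mul_diagonal]
        simp [fun i => (hpos i).ne', hM']
  rw [rank_of_isUnit _ (IsUnit.of_mul_eq_one _ h)]
  simp

end spectral

/-! ### Necessity of the criterion and the boundary -/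

/-- A linear entanglement witness on two qubits: a partially transposed projection. -/
theorem separableStates_witness_nonneg {σ : Matrix (Fin 2 × Fin 2) (Fin 2 × Fin 2) ℂ}
    (hσ : σ ∈ separableStates (Fin 2) (Fin 2)) (a b : ℝ) :
    0 ≤ a ^ 2 * (σ (1, 1) (1, 1)).re + b ^ 2 * (σ (0, 0) (0, 0)).re +
      2 * (a * b * (σ (0, 1) (1, 0)).re) := by
  refine convexHull_min (t := {σ : Matrix (Fin 2 × Fin 2) (Fin 2 × Fin 2) ℂ |
    0 ≤ a ^ 2 * (σ (1, 1) (1, 1)).re + b ^ 2 * (σ (0, 0) (0, 0)).re +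
      2 * (a * b * (σ (0, 1) (1, 0)).re)}) ?_ ?_ hσ
  · rintro _ ⟨A, hA, B, hB, rfl⟩
    simp only [Set.mem_ofPred_eq, kroneckerMap_apply]
    have key : ∀ C : Matrix (Fin 2) (Fin 2) ℂ, C.PosSemidef →
        0 ≤ (C 0 0).re ∧ 0 ≤ (C 1 1).re ∧ (C 0 0).im = 0 ∧ (C 1 1).im = 0 ∧
        (C 0 1).re = (C 1 0).re ∧ (C 0 1).im = -(C 1 0).im ∧
        (C 1 0).re ^ 2 + (C 1 0).im ^ 2 ≤ (C 0 0).re * (C 1 1).re := by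
      intro C hC
      have h0 := Complex.nonneg_iff.mp (hC.diag_nonneg (i := 0))
      have h1 := Complex.nonneg_iff.mp (hC.diag_nonneg (i := 1))
      have hs : star (C 1 0) = C 0 1 := hC.isHermitian.apply 0 1
      have hre : (C 0 1).re = (C 1 0).re := by rw [← hs]; simp
      have him : (C 0 1).im = -(C 1 0).im := by rw [← hs]; simp
      have hd := (Complex.nonneg_iff.mp hC.det_nonneg).1
      rw [det_fin_two, Complex.sub_re, Complex.mul_re, Complex.mul_re, hre, him, ← h0.2,
        ← h1.2] at hd
      exact ⟨h0.1, h1.1, h0.2.symm, h1.2.symm, hre, him, by nlinarith⟩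
    obtain ⟨a0, a1, ai0, ai1, ar, ai, ad⟩ := key A hA.1
    obtain ⟨b0, b1, bi0, bi1, br, bi, bd⟩ := key B hB.1
    rw [Complex.mul_re, Complex.mul_re, Complex.mul_re, ai0, ai1, ar, ai]
    -- Cauchy–Schwarz for the off-diagonal entries, combined with the nonnegative determinants of
    -- `A` and `B`.
    have hR : ((A 1 0).re * (B 1 0).re + (A 1 0).im * (B 1 0).im) ^ 2 ≤
        ((A 1 1).re * (B 1 1).re) * ((A 0 0).re * (B 0 0).re) := by
      have := mul_le_mul ad bd (by positivity) (by positivity)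
      nlinarith [sq_nonneg ((A 1 0).re * (B 1 0).im - (A 1 0).im * (B 1 0).re)]
    generalize hP : (A 1 1).re * (B 1 1).re = p at hR ⊢
    generalize hQ : (A 0 0).re * (B 0 0).re = q at hR ⊢
    have p0 : 0 ≤ p := hP ▸ mul_nonneg a1 b1
    have q0 : 0 ≤ q := hQ ▸ mul_nonneg a0 b0
    have := (abs_le_of_sq_le_sq'
      (a := 2 * (a * b * ((A 1 0).re * (B 1 0).re + (A 1 0).im * (B 1 0).im)))
      (b := a ^ 2 * p + b ^ 2 * q) (by
        have := mul_le_mul_of_nonneg_left hR (by positivity : 0 ≤ 4 * (a * b) ^ 2)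
        nlinarith [sq_nonneg (a ^ 2 * p - b ^ 2 * q)]) (by positivity)).1
    linarith
  · intro x hx y hy s t hs ht _
    simp only [Set.mem_ofPred_eq] at hx hy ⊢
    have := add_nonneg (mul_nonneg hs hx) (mul_nonneg ht hy)
    simp only [Matrix.add_apply, Matrix.smul_apply, Complex.add_re, Complex.real_smul,
      Complex.re_ofReal_mul]
    linarith

/-- The basis `|01⟩ - |10⟩, |00⟩, |01⟩ + |10⟩, |11⟩`, normalized. -/
noncomputable def singletBasisMatrix : Matrix (Fin 2 × Fin 2) (Fin 4) ℂ :=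
  Matrix.of fun p => (![![![0, 1, 0, 0], ![((√2)⁻¹ : ℝ), 0, ((√2)⁻¹ : ℝ), 0]],
    ![![-((√2)⁻¹ : ℝ), 0, ((√2)⁻¹ : ℝ), 0], ![0, 0, 0, 1]]] : Fin 2 → Fin 2 → Fin 4 → ℂ) p.1 p.2

theorem inv_sqrt_two_mul_self : (((√2)⁻¹ : ℝ) : ℂ) * (((√2)⁻¹ : ℝ) : ℂ) = 1 / 2 := by
  rw [← Complex.ofReal_mul, ← mul_inv, Real.mul_self_sqrt (by norm_num)]
  norm_num

theorem singletBasisMatrix_conjTranspose_mul : singletBasisMatrixᴴ * singletBasisMatrix = 1 := by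
  have h := inv_sqrt_two_mul_self
  set r : ℝ := (√2)⁻¹ with hr
  ext i j
  fin_cases i <;> fin_cases j <;>
    simp [Matrix.mul_apply, Fintype.sum_prod_type, singletBasisMatrix, -Complex.ofReal_inv, ← hr] <;>
    linear_combination 2 * h

/-- Absolute separability allows the eigenbasis to be rotated onto the singlet basis, where the
witness detects a violation. No ordering of `l` is required, which matters for the perturbed spectra
used at the boundary. -/
theorem le_of_mem_AS {M : Matrix (Fin 2 × Fin 2) (Fin 4) ℂ} {l : Fin 4 → ℝ} (hM : Mᴴ * M = 1)
    (h1 : 0 < l 1) (h3 : 0 < l 3) (h : M * (diagonal fun i => (l i : ℂ)) * Mᴴ ∈ AS) :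
    l 0 - l 2 ≤ 2 * Real.sqrt (l 1 * l 3) := by
  have hM' : M * Mᴴ = 1 := (mul_eq_one_comm_of_card_eq _ _ _ (by simp)).mp hM
  have hU : singletBasisMatrix * Mᴴ ∈ unitaryGroup (Fin 2 × Fin 2) ℂ := by
    rw [mem_unitaryGroup_iff', star_eq_conjTranspose, conjTranspose_mul,
      conjTranspose_conjTranspose, Matrix.mul_assoc, ← Matrix.mul_assoc singletBasisMatrixᴴ,
      singletBasisMatrix_conjTranspose_mul, Matrix.one_mul, hM']
  have hs := h.2 _ hU
  have heq : singletBasisMatrix * Mᴴ * (M * (diagonal fun i => (l i : ℂ)) * Mᴴ) *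
      star (singletBasisMatrix * Mᴴ) =
      singletBasisMatrix * (diagonal fun i => (l i : ℂ)) * singletBasisMatrixᴴ := by
    calc _ = singletBasisMatrix * ((Mᴴ * M) * (diagonal fun i => (l i : ℂ)) * (Mᴴ * M)) *
          singletBasisMatrixᴴ := by
          simp only [star_eq_conjTranspose, conjTranspose_mul, conjTranspose_conjTranspose,
            Matrix.mul_assoc]
      _ = _ := by rw [hM, Matrix.one_mul, Matrix.mul_one]
  rw [heq] at hs
  -- These weights make both diagonal terms equal to `l 1 * l 3`; dividing by `√(l 1 * l 3)` gives
  -- the bound.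
  have hw := separableStates_witness_nonneg hs (√(l 1)) (√(l 3))
  have e00 : (singletBasisMatrix * (diagonal fun i => (l i : ℂ)) * singletBasisMatrixᴴ)
      (0, 0) (0, 0) = l 1 := by
    simp [Matrix.mul_apply, Fin.sum_univ_four, singletBasisMatrix, diagonal_apply]
  have e11 : (singletBasisMatrix * (diagonal fun i => (l i : ℂ)) * singletBasisMatrixᴴ)
      (1, 1) (1, 1) = l 3 := by
    simp [Matrix.mul_apply, Fin.sum_univ_four, singletBasisMatrix, diagonal_apply]
  have e01 : (singletBasisMatrix * (diagonal fun i => (l i : ℂ)) * singletBasisMatrixᴴ)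
      (0, 1) (1, 0) = (((l 2 - l 0) / 2 : ℝ) : ℂ) := by
    have h := inv_sqrt_two_mul_self
    set r : ℝ := (√2)⁻¹ with hr
    rw [Matrix.mul_apply]
    simp [Fin.sum_univ_four, singletBasisMatrix, mul_diagonal, -Complex.ofReal_inv, ← hr]
    linear_combination (l 2 - l 0 : ℂ) * h
  rw [e00, e11, e01, Complex.ofReal_re, Complex.ofReal_re, Complex.ofReal_re, Real.sq_sqrt h1.le,
    Real.sq_sqrt h3.le, ← Real.sqrt_mul h1.le] at hw
  have hp : 0 < l 1 * l 3 := mul_pos h1 h3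
  have hq := Real.mul_self_sqrt hp.le
  have hq0 := Real.sqrt_pos.mpr hp
  by_contra! hlt
  nlinarith [mul_lt_mul_of_pos_left hlt hq0]

/-- Moving a small weight `ε` from `λ₃` to `λ₁` fixes `λ₂, λ₄` and raises `λ₁ - λ₃` by `2ε`, so
states outside `AS` lie arbitrarily close. -/
theorem mem_boundaryAS_of_spectrum {M : Matrix (Fin 2 × Fin 2) (Fin 4) ℂ} {l : Fin 4 → ℝ}
    (hM : Mᴴ * M = 1) (hpos : ∀ i, 0 < l i)
    (hcrit : l 0 - l 2 = 2 * Real.sqrt (l 1 * l 3))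
    (h : M * (diagonal fun i => (l i : ℂ)) * Mᴴ ∈ AS) :
    M * (diagonal fun i => (l i : ℂ)) * Mᴴ ∈ boundaryAS := by
  have hsum : ∑ i, l i = 1 := by
    have := h.1.2
    rw [trace_mul_comm, ← Matrix.mul_assoc, hM, Matrix.one_mul, trace_diagonal] at this
    exact_mod_cast this
  refine ⟨⟨_, h.1⟩, ⟨subset_closure h, fun hint => ?_⟩, rfl⟩
  obtain ⟨u, hu, hsub⟩ := mem_nhds_induced _ _ _ |>.mp (mem_interior_iff_mem_nhds.mp hint)
  let f : ℝ → Fin 4 → ℝ := fun ε i => l i + ε * (![1, 0, -1, 0] : Fin 4 → ℝ) i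
  have hf : Continuous fun ε => M * (diagonal fun i => (f ε i : ℂ)) * Mᴴ := by
    have : Continuous f := by fun_prop
    have h2 : Continuous fun ε => (diagonal fun i => (f ε i : ℂ) : Matrix (Fin 4) (Fin 4) ℂ) :=
      Continuous.matrix_diagonal (by fun_prop)
    exact (continuous_const.matrix_mul h2).matrix_mul continuous_const
  have hf0 : f 0 = l := by simp [f]
  have hu' : ∀ᶠ ε in nhds (0 : ℝ), M * (diagonal fun i => (f ε i : ℂ)) * Mᴴ ∈ u := by
    apply hf.continuousAt
    simpa only [hf0] using hu
  -- The bound `ε < l 2` keeps the perturbed operator positive.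
  obtain ⟨ε, hεu, hε0, hε2⟩ := ((hu'.filter_mono nhdsWithin_le_nhds).and
    (Ioo_mem_nhdsGT (hpos 2))).exists
  have f0 : f ε 0 = l 0 + ε := by simp [f]
  have f1 : f ε 1 = l 1 := by simp [f]
  have f2 : f ε 2 = l 2 - ε := by simp [f, sub_eq_add_neg]
  have f3 : f ε 3 = l 3 := by simp [f]
  have hd := mem_densityMatrices_of_spectrum (l := f ε) hM
    (by
      intro i
      have p0 := hpos 0
      fin_cases i
      · change 0 ≤ f ε 0
        linarith
      · change 0 ≤ f ε 1
        exact f1 ▸ (hpos 1).le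
      · change 0 ≤ f ε 2
        linarith
      · change 0 ≤ f ε 3
        exact f3 ▸ (hpos 3).le)
    (by
      rw [Fin.sum_univ_four] at hsum ⊢
      linarith)
  have hAS : (⟨_, hd⟩ : densityMatrices (Fin 2 × Fin 2)) ∈ (Subtype.val ⁻¹' AS : Set _) :=
    hsub hεu
  have := le_of_mem_AS (l := f ε) hM (f1 ▸ hpos 1) (f3 ▸ hpos 3) hAS
  rw [f0, f1, f2, f3] at this
  linarith

/-! ### The critical family -/

/-- At a fixed ratio, `√(λ₂λ₄) = √κ λ₄`, so every defining condition is linear or a linear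
inequality. -/
theorem IsCriticalSpectrum.convex_combination {κ : ℝ} {l l' : Fin 4 → ℝ}
    (hl : IsCriticalSpectrum l) (hκ : l 1 / l 3 = κ) (hl' : IsCriticalSpectrum l')
    (hκ' : l' 1 / l' 3 = κ) {a b : ℝ} (ha : 0 ≤ a) (hb : 0 ≤ b) (hab : a + b = 1) :
    IsCriticalSpectrum (a • l + b • l') ∧ (a • l + b • l') 1 / (a • l + b • l') 3 = κ := by
  have hpos : ∀ i, 0 < (a • l + b • l') i := by
    intro i
    simp only [Pi.add_apply, Pi.smul_apply, smul_eq_mul]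
    have p := hl.pos i
    have p' := hl'.pos i
    rcases ha.eq_or_lt with rfl | ha
    · have : b = 1 := by linarith
      subst this
      simpa using p'
    · positivity
  have e : l 1 = κ * l 3 := by rw [← hκ]; field_simp [(hl.pos 3).ne']
  have e' : l' 1 = κ * l' 3 := by rw [← hκ']; field_simp [(hl'.pos 3).ne']
  have e'' : (a • l + b • l') 1 = κ * (a • l + b • l') 3 := by
    simp only [Pi.add_apply, Pi.smul_apply, smul_eq_mul, e, e']
    ring
  have hs : ∀ x : ℝ, 0 < x → √(κ * x * x) = √κ * x := by
    intro x hx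
    rw [mul_assoc, Real.sqrt_mul' _ (by positivity), Real.sqrt_mul_self hx.le]
  refine ⟨⟨?_, hpos, ?_, ?_⟩, ?_⟩
  · intro i j hij
    have h := hl.antitone hij
    have h' := hl'.antitone hij
    simp only [Pi.add_apply, Pi.smul_apply, smul_eq_mul]
    gcongr
  · simp only [Pi.add_apply, Pi.smul_apply, smul_eq_mul, Finset.sum_add_distrib, ← Finset.mul_sum,
      hl.sum_eq_one, hl'.sum_eq_one]
    linarith
  · have c := hl.critical
    have c' := hl'.critical
    rw [e, hs _ (hl.pos 3)] at c
    rw [e', hs _ (hl'.pos 3)] at c'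
    rw [e'', hs _ (hpos 3)]
    simp only [Pi.add_apply, Pi.smul_apply, smul_eq_mul]
    linear_combination a * c + b * c'
  · rw [e'', mul_div_cancel_right₀ _ (hpos 3).ne']

theorem convex_criticalFamily (ψ : TwoQubitBasis) (κ : ℝ) : Convex ℝ (criticalFamily ψ κ) := by
  rintro _ ⟨l, hl, hκ, rfl⟩ _ ⟨l', hl', hκ', rfl⟩ a b ha hb hab
  obtain ⟨h, h'⟩ := hl.convex_combination hκ hl' hκ' ha hb hab
  refine ⟨_, h, h', ?_⟩
  simp only [spectralState, Finset.smul_sum, ← Finset.sum_add_distrib]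
  refine Finset.sum_congr rfl fun i _ => ?_
  ext p q
  simp
  ring

theorem IsCriticalSpectrum.spectralState_mem {l : Fin 4 → ℝ} (hl : IsCriticalSpectrum l)
    (ψ : TwoQubitBasis) :
    spectralState ψ l ∈ AS ∧ (spectralState ψ l).rank = 4 ∧ spectralState ψ l ∈ boundaryAS := by
  have hM := basisMatrix_conjTranspose_mul ψ
  rw [spectralState_eq]
  have h := mem_AS_of_spectrum hM hl.antitone hl.pos hl.sum_eq_one hl.critical.le
  exact ⟨h, rank_of_spectrum hM hl.pos, mem_boundaryAS_of_spectrum hM hl.pos hl.critical h⟩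

theorem spectralState_injective (ψ : TwoQubitBasis) : Function.Injective (spectralState ψ) := by
  intro l l' h
  have hM := basisMatrix_conjTranspose_mul ψ
  have key : ∀ k : Fin 4 → ℝ, (basisMatrix ψ)ᴴ * spectralState ψ k * basisMatrix ψ =
      diagonal fun i => (k i : ℂ) := by
    intro k
    calc _ = (basisMatrix ψ)ᴴ * basisMatrix ψ * (diagonal fun i => (k i : ℂ)) *
          ((basisMatrix ψ)ᴴ * basisMatrix ψ) := by
          rw [spectralState_eq]
          simp only [Matrix.mul_assoc]
      _ = _ := by rw [hM, Matrix.one_mul, Matrix.mul_one]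
  have := key l
  rw [h, key l'] at this
  ext i
  exact_mod_cast (congrFun (diagonal_injective this) i).symm

theorem mixture_notMem_extremePoints {σ₁ σ₂ : Matrix (Fin 2 × Fin 2) (Fin 2 × Fin 2) ℂ}
    (h₁ : σ₁ ∈ AS) (h₂ : σ₂ ∈ AS) (hne : σ₁ ≠ σ₂) {x : ℝ} (hx0 : 0 < x) (hx1 : x < 1) :
    x • σ₁ + (1 - x) • σ₂ ∉ AS.extremePoints ℝ := by
  intro h
  obtain ⟨e₁, e₂⟩ := (mem_extremePoints.mp h).2 _ h₁ _ h₂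
    ⟨x, 1 - x, hx0, by linarith, by ring, rfl⟩
  exact hne (e₁.trans e₂.symm)

/-- With `λ₄ = t` and `λ₂ = 5t/2`, the trace fixes `λ₁ + λ₃ = 1 - 7t/2` and criticality fixes `λ₁ -
λ₃ = 2t√(5/2)`. The lower bound on `t` ensures `λ₃ ≤ λ₂`, the upper one `λ₄ ≤ λ₃`. -/
theorem exists_isCriticalSpectrum {t : ℝ} (h1 : 1 / 10 ≤ t) (h2 : t ≤ 11 / 100) :
    ∃ l : Fin 4 → ℝ, IsCriticalSpectrum l ∧ l 1 / l 3 = 5 / 2 ∧ l 3 = t := by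
  have hr : √(5 / 2 : ℝ) * √(5 / 2 : ℝ) = 5 / 2 := Real.mul_self_sqrt (by norm_num)
  set r := √(5 / 2 : ℝ) with hrd
  have r0 : 0 ≤ r := Real.sqrt_nonneg _
  have r1 : 158 / 100 ≤ r := by nlinarith
  have r2 : r ≤ 159 / 100 := by nlinarith
  have ht : 0 < t := by linarith
  have b1 : t * (158 / 100) ≤ t * r := by gcongr
  have b2 : t * r ≤ t * (159 / 100) := by gcongr
  let l : Fin 4 → ℝ :=
    ![(1 - 7 / 2 * t) / 2 + t * r, 5 / 2 * t, (1 - 7 / 2 * t) / 2 - t * r, t]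
  have e0 : l 0 = (1 - 7 / 2 * t) / 2 + t * r := rfl
  have e1 : l 1 = 5 / 2 * t := rfl
  have e2 : l 2 = (1 - 7 / 2 * t) / 2 - t * r := rfl
  have e3 : l 3 = t := rfl
  refine ⟨l, ⟨?_, ?_, ?_, ?_⟩, ?_, e3⟩
  · refine Fin.antitone_iff_succ_le.mpr fun i => ?_
    fin_cases i
    · change l 1 ≤ l 0
      linarith
    · change l 2 ≤ l 1
      linarith
    · change l 3 ≤ l 2
      linarith
  · intro i
    fin_cases i
    · change 0 < l 0
      linarith
    · change 0 < l 1
      linarith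
    · change 0 < l 2
      linarith
    · exact ht
  · rw [Fin.sum_univ_four]
    linarith
  · rw [e0, e1, e2, e3, mul_assoc, Real.sqrt_mul (by norm_num), Real.sqrt_mul_self ht.le]
    ring
  · rw [e1, e3, mul_div_cancel_right₀ _ ht.ne']

end

/-! ### Assembly -/

theorem proposition4 :
    -- rank-4 absolutely separable boundary states with critical spectrum that are not extreme
    (∃ ρ ∈ AS, ρ.rank = 4 ∧ ρ ∈ boundaryAS ∧ ρ ∉ AS.extremePoints ℝ ∧
      ∃ (ψ : TwoQubitBasis) (l : Fin 4 → ℝ), IsCriticalSpectrum l ∧ ρ = spectralState ψ l) ∧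
    -- the family with a common eigenbasis and a common ratio of the second to the fourth
    -- eigenvalue: it is convex, it consists of rank-4 absolutely separable boundary states, and
    -- proper mixtures of distinct members are not extreme
    (∀ (ψ : TwoQubitBasis) (κ : ℝ),
      Convex ℝ (criticalFamily ψ κ) ∧
      (∀ ρ ∈ criticalFamily ψ κ, ρ ∈ AS ∧ ρ.rank = 4 ∧ ρ ∈ boundaryAS) ∧
      (∀ σ₁ ∈ criticalFamily ψ κ, ∀ σ₂ ∈ criticalFamily ψ κ, σ₁ ≠ σ₂ →
        ∀ x : ℝ, 0 < x → x < 1 → x • σ₁ + (1 - x) • σ₂ ∉ AS.extremePoints ℝ)) ∧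
    -- for the ratio 5/2 the family has distinct members, with least eigenvalues 0.1 and 0.11
    (∀ ψ : TwoQubitBasis, ∃ l l' : Fin 4 → ℝ,
      IsCriticalSpectrum l ∧ l 1 / l 3 = 5 / 2 ∧ l 3 = 1 / 10 ∧
      IsCriticalSpectrum l' ∧ l' 1 / l' 3 = 5 / 2 ∧ l' 3 = 11 / 100 ∧
      spectralState ψ l ≠ spectralState ψ l') := by
  have hmem : ∀ (ψ : TwoQubitBasis) (κ : ℝ), ∀ ρ ∈ criticalFamily ψ κ,
      ρ ∈ AS ∧ ρ.rank = 4 ∧ ρ ∈ boundaryAS := by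
    rintro ψ κ _ ⟨l, hl, -, rfl⟩
    exact hl.spectralState_mem ψ
  obtain ⟨l, hl, hκ, hl3⟩ := exists_isCriticalSpectrum (t := 1 / 10) le_rfl (by norm_num)
  obtain ⟨l', hl', hκ', hl3'⟩ := exists_isCriticalSpectrum (t := 11 / 100) (by norm_num) le_rfl
  have hne : ∀ ψ : TwoQubitBasis, spectralState ψ l ≠ spectralState ψ l' := by
    intro ψ h
    have := congrFun (spectralState_injective ψ h) 3
    rw [hl3, hl3'] at this
    norm_num at this
  refine ⟨?_, fun ψ κ => ⟨convex_criticalFamily ψ κ, hmem ψ κ, ?_⟩,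
    fun ψ => ⟨l, l', hl, hκ, hl3, hl', hκ', hl3', hne ψ⟩⟩
  · let ψ : TwoQubitBasis :=
      (EuclideanSpace.basisFun (Fin 2 × Fin 2) ℂ).reindex finProdFinEquiv
    have h1 : spectralState ψ l ∈ criticalFamily ψ (5 / 2) := ⟨l, hl, hκ, rfl⟩
    have h2 : spectralState ψ l' ∈ criticalFamily ψ (5 / 2) := ⟨l', hl', hκ', rfl⟩
    -- The midpoint of the two explicit members is the witness; convexity makes it critical itself.
    have h := convex_criticalFamily ψ (5 / 2) h1 h2 (a := 1 / 2) (b := 1 - 1 / 2) (by norm_num)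
      (by norm_num) (by norm_num)
    obtain ⟨ha, hr, hb⟩ := hmem _ _ _ h
    obtain ⟨k, hk, -, hk'⟩ := id h
    exact ⟨_, ha, hr, hb, mixture_notMem_extremePoints (hl.spectralState_mem ψ).1
      (hl'.spectralState_mem ψ).1 (hne ψ) (by norm_num) (by norm_num), ψ, k, hk, hk'⟩
  · intro σ₁ h₁ σ₂ h₂ hne x hx0 hx1
    exact mixture_notMem_extremePoints (hmem _ _ _ h₁).1 (hmem _ _ _ h₂).1 hne hx0 hx1
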